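/- Let ${\sf V}$ be the three-element poset with a minimum element $c$ covered by two incomparable elements $\ell$ and $r$. For an integer $k\ge 1$ let $[k]$ be the chain $1<2<\dots<k$, let ${\sf V}_k={\sf V}\times[k]$ have the product order, and write $c_i=(c,i)$, $\ell_i=(\ell,i)$, $r_i=(r,i)$ for $i\in[k]$. Let $\mathcal J({\sf V}_k)$ be the set of order ideals (down-closed subsets) of ${\sf V}_k$, and let $\rho:\mathcal J({\sf V}_k)\to\mathcal J({\sf V}_k)$ be rowmotion, the invertible map that sends $I$ to the order ideal generated by the minimal elements of ${\sf V}_k\setminus I$. For $s\in{\sf V}_k$ let $\chi_s(I)=1$ if $s\in I$ and $\chi_s(I)=0$ otherwise. A statistic $f:\mathcal J({\sf V}_k)\to\mathbb C$ is called $a$-mesic if $\frac{1}{\#\mathcal R}\sum_{I\in\mathcal R}f(I)=a$ for every $\rho$-orbit $\mathcal R$. Then, for the action of $\rho$ on $\mathcal J({\sf V}_k)$: 1. the statistic $\chi_{\ell_i}-\chi_{r_i}$ is $0$-mesic for all $i\in[k]$; 2. the statistic $\chi_{\ell_1}+\chi_{r_1}-\chi_{c_k}$ is $\frac{2(k-1)}{k+2}$-mesic.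 -/

import Mathlib

noncomputable section

/-- The order ideal generated by the minimal elements of the complement of `I`. -/
def rowmotionFun {P : Type*} [PartialOrder P] (I : LowerSet P) : LowerSet P :=
  lowerClosure {x | Minimal (fun y => y ∉ I) x}

/-- The complement of the order filter generated by the maximal elements of `I`. -/
def rowmotionInvFun {P : Type*} [PartialOrder P] (I : LowerSet P) : LowerSet P :=
  (upperClosure {x | Maximal (fun y => y ∈ I) x}).compl

theorem rowmotionInvFun_rowmotionFun {P : Type*} [PartialOrder P] [Finite P]
    (I : LowerSet P) : rowmotionInvFun (rowmotionFun I) = I := by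
  ext x
  simp only [rowmotionInvFun, rowmotionFun, SetLike.mem_coe, UpperSet.mem_compl_iff,
    mem_upperClosure, Set.mem_ofPred_eq, not_exists, not_and]
  constructor
  · intro h
    by_contra hx
    obtain ⟨m, hmx, hm⟩ := (Set.toFinite {y | y ∉ I}).exists_le_minimal hx
    refine h m ⟨subset_lowerClosure hm, ?_⟩ hmx
    rintro b ⟨c, hc, hbc⟩ hmb
    exact hbc.trans (hc.2 hm.1 (hmb.trans hbc))
  · rintro hx y ⟨⟨c, hc, hyc⟩, hmax⟩ hyx
    have hcy : c ≤ y := hmax (subset_lowerClosure hc) hyc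
    exact hc.1 (I.lower (hcy.trans hyx) hx)

theorem rowmotionFun_rowmotionInvFun {P : Type*} [PartialOrder P] [Finite P]
    (I : LowerSet P) : rowmotionFun (rowmotionInvFun I) = I := by
  have key : ∀ y, y ∉ rowmotionInvFun I ↔ ∃ a, Maximal (fun y => y ∈ I) a ∧ a ≤ y := by
    intro y
    simp [rowmotionInvFun]
  ext x
  simp only [rowmotionFun, SetLike.mem_coe, mem_lowerClosure, Set.mem_ofPred_eq]
  constructor
  · rintro ⟨c, hc, hxc⟩
    obtain ⟨a, ha, hac⟩ := (key c).1 hc.1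
    have hca : c ≤ a := hc.2 ((key a).2 ⟨a, ha, le_rfl⟩) hac
    exact I.lower (hxc.trans hca) ha.1
  · intro hx
    obtain ⟨m, hxm, hm⟩ := (Set.toFinite {y | y ∈ I}).exists_le_maximal hx
    refine ⟨m, ⟨(key m).2 ⟨m, hm, le_rfl⟩, ?_⟩, hxm⟩
    intro b hb hbm
    obtain ⟨a, ha, hab⟩ := (key b).1 hb
    exact (ha.2 hm.1 (hab.trans hbm)).trans hab

/-- (Order-ideal) rowmotion on a finite poset `P`, as an invertible map on the set
`LowerSet P` of order ideals of `P`: an ideal `I` is sent to the ideal generated by the minimal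
elements of the complement of `I`. -/
def rowmotion (P : Type*) [PartialOrder P] [Finite P] : Equiv.Perm (LowerSet P) where
  toFun := rowmotionFun
  invFun := rowmotionInvFun
  left_inv := rowmotionInvFun_rowmotionFun
  right_inv := rowmotionFun_rowmotionInvFun

/-- The statistic `f` is `c`-mesic for the invertible map `φ` on the finite set `S`: the average
of `f` over every `φ`-orbit is `c`. -/
def IsMesic {S : Type*} [Finite S] (φ : Equiv.Perm S) (f : S → ℂ) (c : ℂ) : Prop :=
  ∀ O : Set S, (∃ x, O = {y | φ.SameCycle x y}) →
    (1 / (O.ncard : ℂ)) * ∑ᶠ y ∈ O, f y = c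

open Classical in
/-- The indicator function `χ_s` of `s ∈ P`, as a statistic on the order ideals of `P`. -/
def idealIndicator {P : Type*} [PartialOrder P] (s : P) (I : LowerSet P) : ℂ :=
  if s ∈ I then 1 else 0

/-- The three-element poset `V`, with minimum `c` covered by `l` and `r`. -/
inductive Vee
  | c
  | l
  | r

instance : Finite Vee :=
  Finite.of_surjective (fun i : Fin 3 => ![Vee.c, Vee.l, Vee.r] i) (by
    rintro (_ | _ | _)
    · exact ⟨0, rfl⟩
    · exact ⟨1, rfl⟩
    · exact ⟨2, rfl⟩)

instance : PartialOrder Vee where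
  le a b := a = Vee.c ∨ a = b
  le_refl _ := Or.inr rfl
  le_trans := by
    rintro a b d (h | rfl) h'
    · exact Or.inl h
    · exact h'
  le_antisymm := by
    rintro a b (rfl | rfl) (h | h)
    · exact h.symm
    · exact h.symm
    · rfl
    · rfl

/-- The chain of V's poset `V × [k]` with the product order, where the chain `[k]` is `Fin k`
(so the chain element `i ∈ {1, …, k}` is represented by `i - 1`). -/
abbrev VeeChain (k : ℕ) : Type := Vee × Fin k

end

/-! Rowmotion permutes each orbit, so coboundaries average to zero; it suffices to write each
statistic as its mean plus a coboundary (`isMesic_of_coboundary`). An ideal is a triple of fibre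
heights l, r ≤ c ≤ k, moved by the rules of `HeightStep`. Let a be c, or k + 1 if l = c or r = c.
Then the set of ages {l, r, a} is translated by one in ℤ/(k+2). Hence functions of age gaps change,
and age sums deviate from a steady increase, only when the age k + 1 wraps to 0. The potentials in
`antisymmPotential_step` and `symmPotential_step` are built from such functions. -/

/-- A statistic that differs from the constant `a` by a coboundary `g ∘ φ - g` is `a`-mesic. -/
theorem isMesic_of_coboundary {S : Type*} [Finite S] (φ : Equiv.Perm S) (f g : S → ℂ) (a : ℂ)
    (h : ∀ x, f x = a + (g (φ x) - g x)) : IsMesic φ f a := by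
  rintro O ⟨x, rfl⟩
  set O : Set S := {y | φ.SameCycle x y} with hO
  have hfin : O.Finite := Set.toFinite O
  have hx : x ∈ O := Equiv.Perm.SameCycle.refl φ x
  have hbij : Set.BijOn φ O O := by
    refine ⟨fun y hy => Equiv.Perm.sameCycle_apply_right.2 hy, φ.injective.injOn,
      fun y hy => ⟨φ⁻¹ y, Equiv.Perm.sameCycle_apply_right.1 ?_, by simp⟩⟩
    simpa [hO] using hy
  have hshift : ∑ᶠ y ∈ O, g (φ y) = ∑ᶠ y ∈ O, g y :=
    finsum_mem_eq_of_bijOn φ hbij fun _ _ => rfl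
  have hconst : ∑ᶠ y ∈ O, a = (O.ncard : ℂ) * a := by
    rw [finsum_mem_eq_finite_toFinset_sum _ hfin, Finset.sum_const, nsmul_eq_mul,
      Set.ncard_eq_toFinset_card O hfin]
  have hsum : ∑ᶠ y ∈ O, f y = (O.ncard : ℂ) * a := by
    rw [finsum_mem_congr rfl fun y _ => h y, finsum_mem_add_distrib hfin,
      finsum_mem_sub_distrib (f := fun y => g (φ y)) (g := g) hfin, hshift, hconst, sub_self,
      add_zero]
  have hcard : (O.ncard : ℂ) ≠ 0 :=
    Nat.cast_ne_zero.2 ((Set.ncard_pos hfin).2 ⟨x, hx⟩).ne'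
  rw [hsum]
  field_simp

namespace Vee

theorem c_le (x : Vee) : Vee.c ≤ x := Or.inl rfl

theorem le_iff {x y : Vee} : x ≤ y ↔ x = Vee.c ∨ x = y := Iff.rfl

end Vee

/-! ### Fibre heights and rowmotion on them. -/

namespace VeeChain

variable {k : ℕ}

/-- The number of elements of the fibre over `x` that lie in the ideal `I`. -/
noncomputable def height (I : LowerSet (VeeChain k)) (x : Vee) : ℕ :=
  sInf {n | ∀ i : Fin k, (x, i) ∈ I → (i : ℕ) < n}

theorem mem_iff_lt_height (I : LowerSet (VeeChain k)) (x : Vee) (i : Fin k) :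
    (x, i) ∈ I ↔ (i : ℕ) < height I x := by
  have hne : {n | ∀ i : Fin k, (x, i) ∈ I → (i : ℕ) < n}.Nonempty := ⟨k, fun i _ => i.2⟩
  refine ⟨fun h => Nat.sInf_mem hne i h, fun h => ?_⟩
  by_contra hi
  refine Nat.notMem_of_lt_sInf h fun j hj => ?_
  by_contra hij
  exact hi (I.lower (Prod.mk_le_mk.2 ⟨le_rfl, Fin.le_def.2 (not_lt.1 hij)⟩) hj)

theorem height_le (I : LowerSet (VeeChain k)) (x : Vee) : height I x ≤ k :=
  Nat.sInf_le fun i _ => i.2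

theorem height_eq {I : LowerSet (VeeChain k)} {x : Vee} {n : ℕ} (hn : n ≤ k)
    (h : ∀ i : Fin k, (x, i) ∈ I ↔ (i : ℕ) < n) : height I x = n := by
  have hk := height_le I x
  rcases lt_trichotomy (height I x) n with hlt | heq | hgt
  · exact absurd ((mem_iff_lt_height I x ⟨_, hlt.trans_le hn⟩).1 ((h _).2 hlt)) (lt_irrefl _)
  · exact heq
  · exact absurd ((h ⟨n, hgt.trans_le hk⟩).1 ((mem_iff_lt_height I x _).2 hgt)) (lt_irrefl _)

theorem height_le_height_c (I : LowerSet (VeeChain k)) (x : Vee) :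
    height I x ≤ height I Vee.c := by
  refine Nat.sInf_le fun i hi => (mem_iff_lt_height I Vee.c i).1 ?_
  exact I.lower (Prod.mk_le_mk.2 ⟨Vee.c_le x, le_rfl⟩) hi

/-- The lower covers of `(y, j)` are its predecessor in the fibre and, for `y ≠ c`, the element `(c,
j)`; both must lie in `I`. -/
theorem minimal_notMem_iff (I : LowerSet (VeeChain k)) (y : Vee) (j : Fin k) :
    Minimal (fun z => z ∉ I) (y, j) ↔
      (j : ℕ) = height I y ∧ (y = Vee.c ∨ (j : ℕ) < height I Vee.c) := by
  constructor
  · rintro ⟨hmem, hmin⟩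
    have hj : height I y ≤ j := not_lt.1 fun h => hmem ((mem_iff_lt_height I y j).2 h)
    refine ⟨le_antisymm ?_ hj, ?_⟩
    · have hle := hmin (y := (y, ⟨height I y, hj.trans_lt j.2⟩))
        (fun h => lt_irrefl _ ((mem_iff_lt_height I y _).1 h)) (Prod.mk_le_mk.2 ⟨le_rfl, hj⟩)
      exact (Prod.mk_le_mk.1 hle).2
    · by_contra! hc
      have hle := hmin (y := (Vee.c, j))
        (fun h => absurd ((mem_iff_lt_height I Vee.c j).1 h) (not_lt.2 hc.2))
        (Prod.mk_le_mk.2 ⟨Vee.c_le y, le_rfl⟩)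
      rcases Vee.le_iff.1 (Prod.mk_le_mk.1 hle).1 with h | h <;> exact hc.1 h
  · rintro ⟨hj, hc⟩
    refine ⟨fun h => absurd ((mem_iff_lt_height I y j).1 h) (by omega), ?_⟩
    rintro ⟨z, m⟩ hz hle
    obtain ⟨hzy, hmj⟩ := Prod.mk_le_mk.1 hle
    have hm : height I z ≤ m := not_lt.1 fun h => hz ((mem_iff_lt_height I z m).2 h)
    have hmj' : (m : ℕ) ≤ j := hmj
    by_cases hzy' : z = y
    · subst hzy'
      exact Prod.mk_le_mk.2 ⟨le_rfl, Fin.le_def.2 (by omega)⟩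
    · obtain rfl : z = Vee.c := (Vee.le_iff.1 hzy).resolve_right hzy'
      rcases hc with hc | hc
      · exact absurd hc.symm hzy'
      · omega

theorem mem_rowmotion_iff (I : LowerSet (VeeChain k)) (x : Vee) (i : Fin k) :
    (x, i) ∈ rowmotion (VeeChain k) I ↔
      ∃ y, x ≤ y ∧ (i : ℕ) ≤ height I y ∧ height I y < k ∧
        (y = Vee.c ∨ height I y < height I Vee.c) := by
  change (x, i) ∈ lowerClosure {z | Minimal (fun y => y ∉ I) z} ↔ _
  simp only [mem_lowerClosure, Set.mem_ofPred_eq, Prod.exists, minimal_notMem_iff,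
    Prod.mk_le_mk, Fin.le_def]
  constructor
  · rintro ⟨y, j, ⟨hj, hc⟩, hxy, hij⟩
    exact ⟨y, hxy, hj ▸ hij, hj ▸ j.2, hj ▸ hc⟩
  · rintro ⟨y, hxy, hi, hk, hc⟩
    exact ⟨y, ⟨_, hk⟩, ⟨rfl, hc⟩, hxy, hi⟩

theorem height_rowmotion_of_ne_c (I : LowerSet (VeeChain k)) {x : Vee} (hx : x ≠ Vee.c) :
    height (rowmotion (VeeChain k) I) x =
      if height I x < height I Vee.c then height I x + 1 else 0 := by
  have hc := height_le I Vee.c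
  refine height_eq (by split_ifs <;> omega) fun i => ?_
  rw [mem_rowmotion_iff]
  constructor
  · rintro ⟨y, hxy, hi, -, h⟩
    obtain rfl : x = y := (Vee.le_iff.1 hxy).resolve_left hx
    rw [if_pos (h.resolve_left hx)]
    omega
  · split_ifs with h
    · exact fun hi => ⟨x, le_rfl, by omega, by omega, Or.inr h⟩
    · exact fun hi => absurd hi (Nat.not_lt_zero _)

/-- A new generator over `c` dominates those over `l` and `r`; if the fibre over `c` is full, only
those two remain to fill it. -/
theorem height_rowmotion_c (I : LowerSet (VeeChain k)) :
    height (rowmotion (VeeChain k) I) Vee.c =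
      if height I Vee.c < k then height I Vee.c + 1
      else max (height (rowmotion (VeeChain k) I) Vee.l)
        (height (rowmotion (VeeChain k) I) Vee.r) := by
  have hl := height_rowmotion_of_ne_c I (x := Vee.l) nofun
  have hr := height_rowmotion_of_ne_c I (x := Vee.r) nofun
  have hck := height_le I Vee.c
  have hlc := height_le_height_c I Vee.l
  have hrc := height_le_height_c I Vee.r
  have hlk := height_le (rowmotion (VeeChain k) I) Vee.l
  have hrk := height_le (rowmotion (VeeChain k) I) Vee.r
  refine height_eq (by split_ifs <;> omega) fun i => ?_
  rw [mem_rowmotion_iff]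
  constructor
  · rintro ⟨y | y | y, -, hi, hk, h⟩
    · rw [if_pos hk]; omega
    · have h := h.resolve_left nofun
      rw [if_pos h] at hl
      split_ifs <;> omega
    · have h := h.resolve_left nofun
      rw [if_pos h] at hr
      split_ifs <;> omega
  · split_ifs with h
    · exact fun hi => ⟨Vee.c, le_rfl, by omega, h, Or.inl rfl⟩
    · intro hi
      rcases lt_max_iff.1 hi with hi | hi
      · split_ifs at hl with hlt
        · exact ⟨Vee.l, Vee.c_le _, by omega, by omega, Or.inr hlt⟩
        · omega
      · split_ifs at hr with hlt
        · exact ⟨Vee.r, Vee.c_le _, by omega, by omega, Or.inr hlt⟩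
        · omega

/-- One step of rowmotion on the fibre heights `(l, c, r)` of an ideal of `V × [k]`. -/
structure HeightStep (k l c r l' c' r' : ℤ) : Prop where
  l_nonneg : 0 ≤ l
  r_nonneg : 0 ≤ r
  l_le : l ≤ c
  r_le : r ≤ c
  c_le : c ≤ k
  l_eq : l < c ∧ l' = l + 1 ∨ l = c ∧ l' = 0
  r_eq : r < c ∧ r' = r + 1 ∨ r = c ∧ r' = 0
  c_eq : c < k ∧ c' = c + 1 ∨ c = k ∧ c' = max l' r'

theorem heightStep_rowmotion (I : LowerSet (VeeChain k)) :
    HeightStep k (height I Vee.l) (height I Vee.c) (height I Vee.r)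
      (height (rowmotion (VeeChain k) I) Vee.l) (height (rowmotion (VeeChain k) I) Vee.c)
      (height (rowmotion (VeeChain k) I) Vee.r) := by
  have hl := height_rowmotion_of_ne_c I (x := Vee.l) nofun
  have hr := height_rowmotion_of_ne_c I (x := Vee.r) nofun
  have hc := height_rowmotion_c I
  have hck := height_le I Vee.c
  have hlc := height_le_height_c I Vee.l
  have hrc := height_le_height_c I Vee.r
  constructor
  any_goals omega
  · split_ifs at hl <;> omega
  · split_ifs at hr <;> omega
  · split_ifs at hc <;> omega

/-! ### Ages and the antisymmetric potential. -/

/-- The oldest of the three ages in `ℤ / (k + 2)` attached to the heights `(l, c, r)`: rowmotion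
increases all the ages by one, and the age `k + 1` is invisible in the heights. -/
def oldestAge (k l c r : ℤ) : ℤ :=
  if l = c ∨ r = c then k + 1 else c

/-- The part of the antisymmetric potential that describes the states with `r < l`, in terms of
the oldest age `a`. -/
def halfPotential (k i l a r : ℤ) : ℤ :=
  max 0 (k + 1 - i - (l - r)) - max 0 (a - r - 1 - i) - max 0 (k + 1 - i - (a - l))
    + 2 * max 0 (l - 1 - i) - 2 * max 0 (r - 1 - i)

/-- A potential whose coboundary is twice the difference of the indicators of `ℓ` and `r` at
level `i`. -/
def antisymmPotential (k i l c r : ℤ) : ℤ :=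
  if r < l then halfPotential k i l (oldestAge k l c r) r
  else if l < r then -halfPotential k i r (oldestAge k l c r) l
  else 0

theorem HeightStep.symm {k l c r l' c' r' : ℤ} (h : HeightStep k l c r l' c' r') :
    HeightStep k r c l r' c' l' :=
  ⟨h.r_nonneg, h.l_nonneg, h.r_le, h.l_le, h.c_le, h.r_eq, h.l_eq, max_comm l' r' ▸ h.c_eq⟩

theorem oldestAge_comm (k l c r : ℤ) : oldestAge k l c r = oldestAge k r c l := by
  simp only [oldestAge, or_comm]

theorem antisymmPotential_comm (k i l c r : ℤ) :
    antisymmPotential k i l c r = -antisymmPotential k i r c l := by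
  unfold antisymmPotential
  rw [oldestAge_comm k r c l]
  split_ifs <;> omega

/-- The first three terms of `halfPotential` depend only on age gaps, so without a wrap only the
last two change, by twice the indicators. At a wrap the gap terms absorb the jump of the last two.
-/
theorem antisymmPotential_step_of_lt {k i l c r l' c' r' : ℤ}
    (h : HeightStep k l c r l' c' r') (hrl : r < l) (hi : 0 ≤ i) :
    2 * ((if i < l then 1 else 0) - (if i < r then 1 else 0)) =
      antisymmPotential k i l' c' r' - antisymmPotential k i l c r := by
  obtain ⟨h1, h2, h3, h4, h5, hl, hr, hc⟩ := h
  obtain ⟨hr, rfl⟩ : r < c ∧ r' = r + 1 := by omega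
  -- The indicator is a discrete derivative of `max 0 (x - i)`.
  have hcount (x : ℤ) : (if i < x then 1 else 0) = max 0 (x - i) - max 0 (x - 1 - i) := by
    split_ifs <;> omega
  rw [hcount, hcount, antisymmPotential, antisymmPotential, if_pos hrl]
  unfold halfPotential oldestAge
  rcases hl with ⟨hl, rfl⟩ | ⟨rfl, rfl⟩
  · rw [if_pos (by omega), if_neg (by omega : ¬ (l = c ∨ r = c))]
    rcases hc with ⟨hc, rfl⟩ | ⟨rfl, rfl⟩
    · rw [if_neg (by omega)]
      ring_nf
    · rw [if_pos (by omega)]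
      ring_nf
  -- Wrap: `l' = 0 < r'`, so the negated branch applies, with new oldest age `l + 1` whether or not
  -- `c = k`.
  · rw [if_neg (by omega), if_pos (by omega), if_pos (by omega : l = l ∨ r = l),
      max_eq_left (by omega : 0 - 1 - i ≤ 0)]
    rcases hc with ⟨hc, rfl⟩ | ⟨rfl, rfl⟩
    · rw [if_neg (by omega)]
      ring_nf
    · rw [if_pos (by omega)]
      ring_nf

theorem antisymmPotential_step {k i l c r l' c' r' : ℤ} (h : HeightStep k l c r l' c' r')
    (hi : 0 ≤ i) :
    2 * ((if i < l then 1 else 0) - (if i < r then 1 else 0)) =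
      antisymmPotential k i l' c' r' - antisymmPotential k i l c r := by
  rcases lt_trichotomy r l with hlt | rfl | hgt
  · exact antisymmPotential_step_of_lt h hlt hi
  · obtain rfl : l' = r' := by have := h.l_eq; have := h.r_eq; omega
    simp [antisymmPotential]
  · have h' := antisymmPotential_step_of_lt h.symm hgt hi
    rw [antisymmPotential_comm k i l', antisymmPotential_comm k i l]
    linear_combination -h'

/-! ### The symmetric potential. -/

/-- A potential whose coboundary measures the deviation of the symmetric statistic from its
average. -/
def symmPotential (k l c r : ℤ) : ℤ :=
  (if l = r then 3 * (l + oldestAge k l c r) else 2 * (l + r + oldestAge k l c r))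
    - (if l = c ∨ r = c then k + 2 else 0)
    + (if l = 0 then k + 2 else 0) + (if r = 0 then k + 2 else 0)

theorem symmPotential_comm (k l c r : ℤ) : symmPotential k l c r = symmPotential k r c l := by
  unfold symmPotential
  rw [oldestAge_comm k r c l]
  split_ifs <;> omega

/-- The weighted age sum grows by 6 = 2(k+2) - 2(k-1), the weight 3 compensating for a repeated age
when l = r. A wrap costs it 2(k+2), or 3(k+2) if l = r; the corrections return k + 2 for the
vanished age k + 1 and k + 2 per height reset to 0. The next state has an age k + 1 exactly when c =
k. -/
theorem symmPotential_step_of_le {k l c r l' c' r' : ℤ} (h : HeightStep k l c r l' c' r')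
    (hrl : r ≤ l) (hk : 1 ≤ k) :
    (if 0 < l then k + 2 else 0) + (if 0 < r then k + 2 else 0)
        - (if k - 1 < c then k + 2 else 0) =
      2 * (k - 1) + (symmPotential k l' c' r' - symmPotential k l c r) := by
  obtain ⟨h1, h2, h3, h4, h5, hl, hr, hc⟩ := h
  have hpos (x : ℤ) (hx : 0 ≤ x) :
      (if 0 < x then k + 2 else 0) = k + 2 - if x = 0 then k + 2 else 0 := by
    split_ifs <;> omega
  rw [hpos l h1, hpos r h2]
  unfold symmPotential oldestAge
  generalize (if l = 0 then k + 2 else 0) = zl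
  generalize (if r = 0 then k + 2 else 0) = zr
  rcases hl with ⟨hl, rfl⟩ | ⟨rfl, rfl⟩
  · obtain ⟨hr, rfl⟩ : r < c ∧ r' = r + 1 := by omega
    rw [if_neg (by omega : ¬ (l = c ∨ r = c)), if_neg (by omega : ¬ (l = c ∨ r = c)),
      if_neg (by omega : ¬ l + 1 = 0), if_neg (by omega : ¬ r + 1 = 0)]
    rcases hc with ⟨hc, rfl⟩ | ⟨rfl, rfl⟩ <;> split_ifs <;> omega
  · simp only [true_or, if_true]
    rcases hr with ⟨hr, rfl⟩ | ⟨rfl, rfl⟩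
    · rw [if_neg (by omega : ¬ r + 1 = 0), if_neg (by omega : ¬ l = r)]
      rcases hc with ⟨hc, rfl⟩ | ⟨rfl, rfl⟩ <;> split_ifs <;> omega
    · rcases hc with ⟨hc, rfl⟩ | ⟨rfl, rfl⟩ <;> split_ifs <;> omega

theorem symmPotential_step {k l c r l' c' r' : ℤ} (h : HeightStep k l c r l' c' r')
    (hk : 1 ≤ k) :
    (if 0 < l then k + 2 else 0) + (if 0 < r then k + 2 else 0)
        - (if k - 1 < c then k + 2 else 0) =
      2 * (k - 1) + (symmPotential k l' c' r' - symmPotential k l c r) := by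
  rcases le_total r l with hle | hle
  · exact symmPotential_step_of_le h hle hk
  · have h' := symmPotential_step_of_le h.symm hle hk
    rw [symmPotential_comm k l' c', symmPotential_comm k l c]
    linear_combination h'

end VeeChain

open VeeChain in
theorem idealIndicator_eq_height {k : ℕ} (x : Vee) (i : Fin k) (I : LowerSet (VeeChain k)) :
    idealIndicator (x, i) I = ((if (i : ℤ) < height I x then 1 else 0 : ℤ) : ℂ) := by
  simp [idealIndicator, mem_iff_lt_height]

open VeeChain in
theorem theorem3p3 (k : ℕ) (hk : 1 ≤ k) :
    (∀ i : Fin k,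
      IsMesic (rowmotion (VeeChain k))
        (fun I => idealIndicator (Vee.l, i) I - idealIndicator (Vee.r, i) I) 0) ∧
    IsMesic (rowmotion (VeeChain k))
      (fun I => idealIndicator (Vee.l, (⟨0, by omega⟩ : Fin k)) I
        + idealIndicator (Vee.r, (⟨0, by omega⟩ : Fin k)) I
        - idealIndicator (Vee.c, (⟨k - 1, by omega⟩ : Fin k)) I)
      (2 * ((k : ℂ) - 1) / ((k : ℂ) + 2)) := by
  refine ⟨fun i => ?_, ?_⟩
  · refine isMesic_of_coboundary _ _ (fun I => (antisymmPotential k i (height I Vee.l)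
      (height I Vee.c) (height I Vee.r) : ℂ) / 2) 0 fun I => ?_
    have h := antisymmPotential_step (i := i) (heightStep_rowmotion I) (by omega)
    have h' := congrArg (Int.cast (R := ℂ)) h
    simp only [idealIndicator_eq_height]
    push_cast at h' ⊢
    linear_combination h' / 2
  · refine isMesic_of_coboundary _ _ (fun I => (symmPotential k (height I Vee.l)
      (height I Vee.c) (height I Vee.r) : ℂ) / (k + 2)) _ fun I => ?_
    have hk2 : (k : ℂ) + 2 ≠ 0 := by exact_mod_cast (by omega : k + 2 ≠ 0)
    have h := symmPotential_step (heightStep_rowmotion I) (by omega)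
    have h' := congrArg (Int.cast (R := ℂ)) h
    simp only [idealIndicator_eq_height]
    push_cast [Nat.cast_sub hk] at h' ⊢
    field_simp
    split_ifs at h' ⊢ <;> linear_combination h'
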